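/- **Setting.** Let $d,N\ge 1$, $[N]=\{1,\dots,N\}$, and consider a network of harmonic oscillators on $[N]^d$ with masses $m_i>0$, pinning strengths $\eta_i>0$, interaction strengths $\xi_{i,j}=\xi_{j,i}>0$ for nearest neighbours $i\sim j$ in $[N]^d$ (at distance one, for the $\ell^1$ norm or for the $\ell^\infty$ norm; the result holds for either convention), and friction strengths $\gamma_i>0$ at the particles of a set $I\subset[N]^d$. Put $\mathbf m=\operatorname{diag}(m_i)$, $\Gamma=\operatorname{diag}(\gamma_i\delta_{i\in I})$, $$B=\sum_{i\sim j}\xi_{i,j}L_{i,j}+\operatorname{diag}(\eta_i),\qquad \langle u,L_{i,j}u\rangle=|u(i)-u(j)|^2,\qquad M=\begin{pmatrix}\Gamma&-\mathbf m^{-1}\\ B&0\end{pmatrix},$$ where each unordered pair $i\sim j$ is counted once. The spectral gap is $\lambda_S=\inf\{\operatorname{Re}\lambda:\lambda\in\operatorname{Spec}(M)\}$. The boundary $\partial[N]^d$ consists of the sites with some coordinate equal to $1$ or $N$. **Proposition.** 1. For all $\lambda\in\mathbb C$, $\det(M-\lambda)=\det(\lambda^2-\lambda\Gamma+\mathbf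 m^{-1}B)$; so $\lambda\in\operatorname{Spec}(M)$ if and only if the right-hand side vanishes. In particular $M$ is invertible if and only if $B$ is. (For this part only the masses need to be positive; the other parameters may be arbitrary real numbers.) 2. Let $\gamma>0$ be independent of $N$, and consider for every $N\ge1$ a network on $[N]^d$ with $I=[N]^d$ and $\Gamma=\gamma\,\mathrm{id}$. If $\inf_{N}\inf_{\lambda\in\operatorname{Spec}(\mathbf m^{-1}B)}\lambda>0$, then there is $c>0$ with $\lambda_S\ge c$ for all $N$. The condition on the infimum holds in particular if $m_i=m$, $\eta_i=\eta$, $\xi_{i,j}=\xi$ for all $N$ and all sites, with fixed $m,\eta,\xi>0$. 3. For every $C$ there is a constant $K$, depending only on $C$ and $d$, such that for all $N\ge1$ and all networks on $[N]^d$ with $I\subset\partial[N]^d$ and $\gamma_i\le C$ for $i\in I$, one has $|\lambda_S|\le K/N$. 4. Let $d=1$, and let $m,\gamma,c_1>0$ and $c_2,C$ be given. There is $c>0$, depending only on these numbers, such that for all $N\ge1$ and all chains on $[N]$ with all masses equal to $m$, with $1\in I$ and $\gamma_1=\gamma$, with $\gamma_i\le C$ for all $i\in I$, with $c_1<\eta_i<c_2$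 for all sites $i$ and $c_1<\xi_{i,i+1}<c_2$ for all bonds, one has $\lambda_S\ge e^{-cN}$. -/

import Mathlib

/-- The sites of the cube `[N]^d`; the coordinates run through `0, …, N - 1` instead of
`1, …, N`. -/
abbrev Site (d N : ℕ) : Type := Fin d → Fin N

/-- The two usual meanings of "nearest neighbours" in `ℤ^d`: at distance one for the `ℓ¹` norm or
at distance one for the `ℓ^∞` norm. They agree for `d = 1`. -/
inductive NeighborNorm where
  | one
  | sup

/-- The nearest neighbour relation `i ∼ j` on `[N]^d`. In the second case the largest of the
`|i_k - j_k|` is one. -/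
def Neighbors {d N : ℕ} (nn : NeighborNorm) (i j : Site d N) : Prop :=
  match nn with
  | .one => ∑ k, |((i k : ℕ) : ℤ) - ((j k : ℕ) : ℤ)| = 1
  | .sup => (∀ k, |((i k : ℕ) : ℤ) - ((j k : ℕ) : ℤ)| ≤ 1) ∧
      ∃ k, |((i k : ℕ) : ℤ) - ((j k : ℕ) : ℤ)| = 1

/-- The boundary of `[N]^d`: some coordinate is the first or the last one. -/
def IsBoundary {d N : ℕ} (i : Site d N) : Prop :=
  ∃ k, (i k : ℕ) = 0 ∨ (i k : ℕ) + 1 = N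

/-- The left terminal end of the one-dimensional chain. -/
def leftEnd (N : ℕ+) : Site 1 N := fun _ => ⟨0, N.pos⟩

/-- The parameters of a network of oscillators on `[N]^d` that enter the drift: masses, pinning
strengths, interaction strengths of (unordered) pairs, the set of the particles subject to friction
and the friction strengths. -/
structure Network (d N : ℕ) where
  mass : Site d N → ℝ
  pin : Site d N → ℝ
  coupling : Sym2 (Site d N) → ℝ
  frictionSet : Finset (Site d N)
  friction : Site d N → ℝ

namespace Network

variable {d N : ℕ}

/-- All the physical parameters of the network are positive. -/
structure Positive (S : Network d N) (nn : NeighborNorm) : Prop where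
  mass_pos : ∀ i, 0 < S.mass i
  pin_pos : ∀ i, 0 < S.pin i
  coupling_pos : ∀ i j, Neighbors nn i j → 0 < S.coupling s(i, j)
  friction_pos : ∀ i ∈ S.frictionSet, 0 < S.friction i

/-- The mass matrix `m`. -/
noncomputable def massMatrix (S : Network d N) : Matrix (Site d N) (Site d N) ℂ :=
  Matrix.diagonal fun i => (S.mass i : ℂ)

/-- The friction matrix `Γ`. -/
noncomputable def frictionMatrix (S : Network d N) : Matrix (Site d N) (Site d N) ℂ :=
  Matrix.diagonal fun i => if i ∈ S.frictionSet then (S.friction i : ℂ) else 0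

/-- The operator `L_{i,j}` with quadratic form `⟨u, L_{i,j} u⟩ = |u(i) - u(j)|²`. -/
noncomputable def bondMatrix (i j : Site d N) : Matrix (Site d N) (Site d N) ℂ :=
  Matrix.vecMulVec (Pi.single i 1 - Pi.single j 1) (Pi.single i 1 - Pi.single j 1)

open Classical in
/-- The negative weighted Neumann Laplacian `-Δ = ∑_{i ∼ j} ξ_{i,j} L_{i,j}`. The sum runs over
unordered pairs; the sum over ordered pairs counts each of them twice. -/
noncomputable def negLaplacian (S : Network d N) (nn : NeighborNorm) :
    Matrix (Site d N) (Site d N) ℂ :=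
  (1 / 2 : ℂ) • ∑ i, ∑ j,
    if Neighbors nn i j then (S.coupling s(i, j) : ℂ) • bondMatrix i j else 0

/-- The Schrödinger operator `B = -Δ + ∑ η_i δ_i`. -/
noncomputable def schrodinger (S : Network d N) (nn : NeighborNorm) :
    Matrix (Site d N) (Site d N) ℂ :=
  S.negLaplacian nn + Matrix.diagonal fun i => (S.pin i : ℂ)

/-- The drift matrix `M` with block rows `(Γ, -m⁻¹)` and `(B, 0)`. -/
noncomputable def driftMatrix (S : Network d N) (nn : NeighborNorm) :
    Matrix (Site d N ⊕ Site d N) (Site d N ⊕ Site d N) ℂ :=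
  Matrix.fromBlocks S.frictionMatrix (-S.massMatrix⁻¹) (S.schrodinger nn) 0

/-- The spectral gap `λ_S = inf {Re λ : λ ∈ Spec M}`. -/
noncomputable def spectralGap (S : Network d N) (nn : NeighborNorm) : ℝ :=
  sInf (Complex.re '' spectrum ℂ (S.driftMatrix nn))

/-- The infimum of the spectrum of `m⁻¹ B`. The spectrum is real when the masses are positive,
so that taking real parts only changes the type. -/
noncomputable def infSpec (S : Network d N) (nn : NeighborNorm) : ℝ :=
  sInf (Complex.re '' spectrum ℂ (S.massMatrix⁻¹ * S.schrodinger nn))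

end Network

/-! Block elimination turns `M - z` into the quadratic pencil `z² - zΓ + m⁻¹B`. A kernel vector `v`
of the pencil, multiplied by the masses and paired with `v`, gives the scalar equation `z²a - zb + E
= 0` with real coefficients `a = ∑ mᵢ|vᵢ|²`, `b = ∑ mᵢγᵢ|vᵢ|²` and `E = ⟨v, Bv⟩ > 0`. If `z` is not
real, then `Re z = b / 2a` and `|z|² = E / a`; if `z` is real, then `zb = z²a + E ≥ E`. All lower
bounds on the gap come from this dichotomy.

For uniform friction `g` one has `b = ga`, and `zg - z²` is an eigenvalue of `m⁻¹B`. Hence `Re z =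
g/2`, or `z` is real and at least `inf Spec(m⁻¹B) / g`.

For boundary friction the `2N^d` eigenvalues have sum `tr M = tr Γ = O(N^(d-1))`, and the smallest
real part is at most the average.

For the chain the danger is an eigenvector that is tiny at the damped end. The equation at site `k`
determines `v(k+1)` from the values to its left, with bounded coefficients because `|z|` is bounded
for non-real `z`. So `v` grows at most exponentially away from the left end, and `b / 2a` is at
least exponentially small (`norm_chainSite_le`, `sum_norm_sq_le`). -/

open scoped Matrix

/-! ### Block determinants and spectra of matrices -/

theorem Matrix.det_fromBlocks_zero_one_neg_one_zero {n R : Type*} [Fintype n] [DecidableEq n]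
    [CommRing R] :
    (Matrix.fromBlocks (0 : Matrix n n R) 1 (-1) (0 : Matrix n n R)).det = 1 := by
  have h : Matrix.fromBlocks (0 : Matrix n n R) 1 (-1) (0 : Matrix n n R) =
      Matrix.fromBlocks 1 1 0 1 * Matrix.fromBlocks 1 0 (-1) 1 *
        Matrix.fromBlocks 1 1 0 1 := by
    simp [Matrix.fromBlocks_multiply]
  rw [h, Matrix.det_mul, Matrix.det_mul]
  simp

theorem Matrix.det_fromBlocks_sub_smul_one {n R : Type*} [Fintype n] [DecidableEq n]
    [CommRing R] (A B D : Matrix n n R) (hD : IsUnit D.det) (z : R) :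
    (Matrix.fromBlocks A (-D) B 0 - z • (1 : Matrix (n ⊕ n) (n ⊕ n) R)).det =
      (z ^ 2 • (1 : Matrix n n R) - z • A + D * B).det := by
  -- Column operations of determinant one: the first factor clears the upper left block using the
  -- invertible `-D`, the second exchanges the block columns with a sign.
  have h : (Matrix.fromBlocks A (-D) B 0 - z • (1 : Matrix (n ⊕ n) (n ⊕ n) R)) *
      Matrix.fromBlocks 1 0 (D⁻¹ * (A - z • (1 : Matrix n n R))) 1 *
        Matrix.fromBlocks (0 : Matrix n n R) 1 (-1) 0 =
      Matrix.fromBlocks D 0 (z • (1 : Matrix n n R))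
        (B - z • (D⁻¹ * (A - z • (1 : Matrix n n R)))) := by
    rw [← Matrix.fromBlocks_one, Matrix.fromBlocks_smul, sub_eq_add_neg, Matrix.fromBlocks_neg,
      Matrix.fromBlocks_add, Matrix.fromBlocks_multiply, Matrix.fromBlocks_multiply]
    simp [Matrix.mul_nonsing_inv_cancel_left _ _ hD, sub_eq_add_neg]
  have h2 := congrArg Matrix.det h
  rw [Matrix.det_mul, Matrix.det_mul, Matrix.det_fromBlocks_zero_one_neg_one_zero,
    Matrix.det_fromBlocks_zero₁₂, Matrix.det_fromBlocks_zero₁₂] at h2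
  simp only [Matrix.det_one, mul_one] at h2
  rw [h2, ← Matrix.det_mul, Matrix.mul_sub, Matrix.mul_smul, Matrix.mul_nonsing_inv_cancel_left _ _ hD, smul_sub,
    smul_smul, ← pow_two]
  congr 1
  abel

theorem Matrix.mem_spectrum_iff_det_sub_smul_one {n K : Type*} [Fintype n] [DecidableEq n]
    [Field K] (A : Matrix n n K) (z : K) :
    z ∈ spectrum K A ↔ (A - z • (1 : Matrix n n K)).det = 0 := by
  rw [spectrum.mem_iff, Algebra.algebraMap_eq_smul_one, ← IsUnit.neg_iff, neg_sub,
    Matrix.isUnit_iff_isUnit_det, isUnit_iff_ne_zero, not_not]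

theorem Matrix.spectrum_nonempty {n K : Type*} [Fintype n] [DecidableEq n] [Nonempty n]
    [Field K] [IsAlgClosed K] (A : Matrix n n K) : (spectrum K A).Nonempty :=
  spectrum.nonempty_of_isAlgClosed_of_finiteDimensional K A

theorem Neighbors.symm {d N : ℕ} {nn : NeighborNorm} {i j : Site d N} (h : Neighbors nn i j) :
    Neighbors nn j i := by
  cases nn with
  | one =>
    simp only [Neighbors] at h ⊢
    rw [← h]
    exact Finset.sum_congr rfl fun k _ => abs_sub_comm _ _
  | sup =>
    simp only [Neighbors] at h ⊢
    refine ⟨fun k => ?_, ?_⟩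
    · rw [abs_sub_comm]; exact h.1 k
    · obtain ⟨k, hk⟩ := h.2
      exact ⟨k, by rw [abs_sub_comm]; exact hk⟩

instance {d : ℕ} {N : ℕ+} : Nonempty (Site d N) := ⟨fun _ => ⟨0, N.pos⟩⟩

/-! ### The quadratic pencil and the energy form -/

namespace Network

variable {d N : ℕ}

theorem isUnit_det_inv_massMatrix (S : Network d N) (hm : ∀ i, 0 < S.mass i) :
    IsUnit (S.massMatrix⁻¹).det := by
  have h : IsUnit S.massMatrix.det := by
    rw [massMatrix, Matrix.det_diagonal, isUnit_iff_ne_zero, Finset.prod_ne_zero_iff]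
    exact fun i _ => by exact_mod_cast (hm i).ne'
  exact Matrix.isUnit_nonsing_inv_det _ h

theorem det_driftMatrix_sub (S : Network d N) (nn : NeighborNorm) (hm : ∀ i, 0 < S.mass i)
    (z : ℂ) :
    (S.driftMatrix nn - z • (1 : Matrix (Site d N ⊕ Site d N) (Site d N ⊕ Site d N) ℂ)).det =
      (z ^ 2 • (1 : Matrix (Site d N) (Site d N) ℂ) - z • S.frictionMatrix +
        S.massMatrix⁻¹ * S.schrodinger nn).det :=
  Matrix.det_fromBlocks_sub_smul_one _ _ _ (S.isUnit_det_inv_massMatrix hm) z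

theorem mem_spectrum_driftMatrix_iff (S : Network d N) (nn : NeighborNorm)
    (hm : ∀ i, 0 < S.mass i) (z : ℂ) :
    z ∈ spectrum ℂ (S.driftMatrix nn) ↔
      (z ^ 2 • (1 : Matrix (Site d N) (Site d N) ℂ) - z • S.frictionMatrix +
        S.massMatrix⁻¹ * S.schrodinger nn).det = 0 := by
  rw [Matrix.mem_spectrum_iff_det_sub_smul_one, S.det_driftMatrix_sub nn hm]

theorem isUnit_driftMatrix_iff (S : Network d N) (nn : NeighborNorm)
    (hm : ∀ i, 0 < S.mass i) :
    IsUnit (S.driftMatrix nn) ↔ IsUnit (S.schrodinger nn) := by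
  have h := S.det_driftMatrix_sub nn hm 0
  simp only [zero_smul, sub_zero, ne_eq, OfNat.ofNat_ne_zero, not_false_eq_true, zero_pow,
    zero_add, Matrix.det_mul] at h
  rw [Matrix.isUnit_iff_isUnit_det, Matrix.isUnit_iff_isUnit_det, h,
    IsUnit.mul_iff]
  exact and_iff_right (S.isUnit_det_inv_massMatrix hm)

/-- The friction strength at a site, which is zero away from the set of damped particles. -/
noncomputable def damping (S : Network d N) (i : Site d N) : ℝ :=
  if i ∈ S.frictionSet then S.friction i else 0

theorem frictionMatrix_eq (S : Network d N) :
    S.frictionMatrix = Matrix.diagonal fun i => (S.damping i : ℂ) := by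
  unfold frictionMatrix damping
  congr 1
  ext i
  split_ifs <;> simp

open Classical in
/-- The interaction strength of two sites, which is zero unless they are neighbours. -/
noncomputable def weight (S : Network d N) (nn : NeighborNorm) (i j : Site d N) : ℝ :=
  if Neighbors nn i j then S.coupling s(i, j) else 0

theorem weight_comm (S : Network d N) (nn : NeighborNorm) (i j : Site d N) :
    S.weight nn i j = S.weight nn j i := by
  unfold weight
  by_cases h : Neighbors nn i j
  · rw [if_pos h, if_pos h.symm, Sym2.eq_swap]
  · rw [if_neg h, if_neg fun h' => h h'.symm]

theorem bondMatrix_mulVec (i j : Site d N) (v : Site d N → ℂ) :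
    bondMatrix i j *ᵥ v = (v i - v j) • (Pi.single i 1 - Pi.single j 1) := by
  rw [bondMatrix, Matrix.vecMulVec_mulVec]
  ext k
  simp [sub_dotProduct, mul_comm]

theorem negLaplacian_mulVec (S : Network d N) (nn : NeighborNorm) (v : Site d N → ℂ)
    (k : Site d N) :
    (S.negLaplacian nn *ᵥ v) k = ∑ j, (S.weight nn k j : ℂ) * (v k - v j) := by
  have h : S.negLaplacian nn = (1 / 2 : ℂ) • ∑ i, ∑ j, (S.weight nn i j : ℂ) • bondMatrix i j := by
    unfold negLaplacian weight
    congr 1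
    refine Finset.sum_congr rfl fun i _ => Finset.sum_congr rfl fun j _ => ?_
    split_ifs <;> simp
  -- A bond acts at both of its ends with opposite signs. By symmetry of the weights the two
  -- contributions at `k` agree, which cancels the factor `1 / 2`.
  have h1 : ∑ i, ∑ j, (S.weight nn i j : ℂ) * ((v i - v j) * (Pi.single i (1 : ℂ) : _ → ℂ) k) =
      ∑ j, (S.weight nn k j : ℂ) * (v k - v j) := by
    rw [Finset.sum_eq_single k]
    · simp
    · intro i _ hi
      simp [hi.symm]
    · simp
  have h2 : ∑ i, ∑ j, (S.weight nn i j : ℂ) * ((v i - v j) * (Pi.single j (1 : ℂ) : _ → ℂ) k) =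
      -∑ j, (S.weight nn k j : ℂ) * (v k - v j) := by
    rw [Finset.sum_comm, Finset.sum_eq_single k]
    · rw [← Finset.sum_neg_distrib]
      refine Finset.sum_congr rfl fun j _ => ?_
      rw [S.weight_comm nn j k, Pi.single_eq_same]
      ring
    · intro i _ hi
      simp [hi.symm]
    · simp
  rw [h, Matrix.smul_mulVec, Matrix.sum_mulVec]
  simp only [Matrix.sum_mulVec, Matrix.smul_mulVec, bondMatrix_mulVec, Pi.smul_apply,
    Finset.sum_apply, Pi.sub_apply, smul_eq_mul, mul_sub (v _ - v _), mul_sub (S.weight nn _ _ : ℂ),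
    Finset.sum_sub_distrib]
  simp only [sub_mul, mul_sub, Finset.sum_sub_distrib] at h1 h2 ⊢
  linear_combination (1 / 2 : ℂ) * h1 - (1 / 2 : ℂ) * h2

theorem schrodinger_mulVec (S : Network d N) (nn : NeighborNorm) (v : Site d N → ℂ)
    (k : Site d N) :
    (S.schrodinger nn *ᵥ v) k = ∑ j, (S.weight nn k j : ℂ) * (v k - v j) + S.pin k * v k := by
  rw [schrodinger, Matrix.add_mulVec, Pi.add_apply, negLaplacian_mulVec, Matrix.mulVec_diagonal]

/-- The quadratic form of the Schrödinger operator. -/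
noncomputable def energy (S : Network d N) (nn : NeighborNorm) (v : Site d N → ℂ) : ℝ :=
  1 / 2 * ∑ i, ∑ j, S.weight nn i j * ‖v i - v j‖ ^ 2 + ∑ i, S.pin i * ‖v i‖ ^ 2

/-- Exchanging the summation indices and averaging the two expressions completes each bond term to a
square. -/
theorem sum_conj_mul_schrodinger_mulVec (S : Network d N) (nn : NeighborNorm)
    (v : Site d N → ℂ) :
    ∑ i, (starRingEnd ℂ) (v i) * (S.schrodinger nn *ᵥ v) i = S.energy nn v := by
  simp only [schrodinger_mulVec, energy, mul_add, Finset.sum_add_distrib]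
  push_cast
  simp only [← Complex.mul_conj']
  congr 1
  · have h : ∑ i, (starRingEnd ℂ) (v i) * ∑ j, (S.weight nn i j : ℂ) * (v i - v j) =
        ∑ i, ∑ j, (S.weight nn i j : ℂ) * ((starRingEnd ℂ) (v i) * (v i - v j)) := by
      refine Finset.sum_congr rfl fun i _ => ?_
      rw [Finset.mul_sum]
      exact Finset.sum_congr rfl fun j _ => by ring
    have h' : ∑ i, ∑ j, (S.weight nn i j : ℂ) * ((starRingEnd ℂ) (v i) * (v i - v j)) =
        ∑ i, ∑ j, (S.weight nn i j : ℂ) * ((starRingEnd ℂ) (v j) * (v j - v i)) := by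
      rw [Finset.sum_comm]
      refine Finset.sum_congr rfl fun i _ => Finset.sum_congr rfl fun j _ => ?_
      rw [S.weight_comm nn]
    have h'' : ∑ i, ∑ j, (S.weight nn i j : ℂ) * ((v i - v j) * (starRingEnd ℂ) (v i - v j)) =
        ∑ i, ∑ j, (S.weight nn i j : ℂ) * ((starRingEnd ℂ) (v i) * (v i - v j)) +
        ∑ i, ∑ j, (S.weight nn i j : ℂ) * ((starRingEnd ℂ) (v j) * (v j - v i)) := by
      simp only [← Finset.sum_add_distrib]
      refine Finset.sum_congr rfl fun i _ => Finset.sum_congr rfl fun j _ => ?_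
      rw [map_sub]
      ring
    rw [h'', h, ← h']
    ring
  · exact Finset.sum_congr rfl fun i _ => by ring

variable {S : Network d N} {nn : NeighborNorm}

theorem weight_nonneg (hc : ∀ i j, Neighbors nn i j → 0 < S.coupling s(i, j))
    (i j : Site d N) : 0 ≤ S.weight nn i j := by
  unfold weight
  split_ifs with h
  · exact (hc i j h).le
  · exact le_rfl

theorem Positive.damping_nonneg (hS : S.Positive nn) (i : Site d N) : 0 ≤ S.damping i := by
  unfold damping
  split_ifs with h
  · exact (hS.friction_pos i h).le
  · exact le_rfl

theorem sum_pin_le_energy (hc : ∀ i j, Neighbors nn i j → 0 < S.coupling s(i, j))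
    (v : Site d N → ℂ) :
    ∑ i, S.pin i * ‖v i‖ ^ 2 ≤ S.energy nn v := by
  unfold energy
  have : 0 ≤ ∑ i, ∑ j, S.weight nn i j * ‖v i - v j‖ ^ 2 :=
    Finset.sum_nonneg fun i _ => Finset.sum_nonneg fun j _ =>
      mul_nonneg (weight_nonneg hc i j) (by positivity)
  linarith

theorem sum_mul_norm_sq_pos {ι : Type*} [Fintype ι] {a : ι → ℝ} (ha : ∀ i, 0 < a i)
    {v : ι → ℂ} (hv : v ≠ 0) : 0 < ∑ i, a i * ‖v i‖ ^ 2 := by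
  obtain ⟨i, hi⟩ := Function.ne_iff.1 hv
  refine Finset.sum_pos' (fun j _ => mul_nonneg (ha j).le (by positivity)) ⟨i, by simp, ?_⟩
  exact mul_pos (ha i) (pow_pos (norm_pos_iff.2 hi) 2)

theorem Positive.energy_pos (hS : S.Positive nn) {v : Site d N → ℂ} (hv : v ≠ 0) :
    0 < S.energy nn v :=
  (sum_mul_norm_sq_pos hS.pin_pos hv).trans_le (sum_pin_le_energy hS.coupling_pos v)

theorem inv_massMatrix (hm : ∀ i, 0 < S.mass i) :
    S.massMatrix⁻¹ = Matrix.diagonal fun i => ((S.mass i : ℂ))⁻¹ := by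
  refine Matrix.inv_eq_right_inv ?_
  rw [massMatrix, Matrix.diagonal_mul_diagonal, ← Matrix.diagonal_one]
  congr 1
  ext i
  exact mul_inv_cancel₀ (by exact_mod_cast (hm i).ne')

theorem exists_eigenvector (hm : ∀ i, 0 < S.mass i) {z : ℂ}
    (hz : z ∈ spectrum ℂ (S.driftMatrix nn)) :
    ∃ v : Site d N → ℂ, v ≠ 0 ∧ ∀ i,
      (z ^ 2 * S.mass i - z * (S.mass i * S.damping i)) * v i + (S.schrodinger nn *ᵥ v) i = 0 := by
  rw [S.mem_spectrum_driftMatrix_iff nn hm, ← Matrix.exists_mulVec_eq_zero_iff] at hz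
  obtain ⟨v, hv, h⟩ := hz
  refine ⟨v, hv, fun i => ?_⟩
  have hi := congrFun h i
  have hmi : (S.mass i : ℂ) ≠ 0 := by exact_mod_cast (hm i).ne'
  rw [inv_massMatrix hm, frictionMatrix_eq, Matrix.add_mulVec, Matrix.sub_mulVec,
    Matrix.smul_mulVec, Matrix.smul_mulVec, ← Matrix.mulVec_mulVec] at hi
  simp only [Matrix.one_mulVec, Pi.add_apply, Pi.sub_apply, Pi.smul_apply, smul_eq_mul,
    Matrix.mulVec_diagonal, Pi.zero_apply] at hi
  field_simp at hi
  linear_combination hi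

theorem quadratic_of_eigenvector {z : ℂ} {v : Site d N → ℂ}
    (h : ∀ i, (z ^ 2 * S.mass i - z * (S.mass i * S.damping i)) * v i +
      (S.schrodinger nn *ᵥ v) i = 0) :
    z ^ 2 * (∑ i, S.mass i * ‖v i‖ ^ 2 : ℝ) -
      z * (∑ i, S.mass i * S.damping i * ‖v i‖ ^ 2 : ℝ) + S.energy nn v = 0 := by
  rw [← sum_conj_mul_schrodinger_mulVec]
  push_cast
  simp only [← Complex.mul_conj']
  rw [Finset.mul_sum, Finset.mul_sum, ← Finset.sum_sub_distrib, ← Finset.sum_add_distrib]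
  refine Finset.sum_eq_zero fun i _ => ?_
  linear_combination (starRingEnd ℂ) (v i) * h i

end Network

/-! ### Real quadratics and the sign of the spectrum -/

/-- Vieta's formulas for the conjugate pair of roots `z`, `z̄`. -/
theorem Complex.re_of_quadratic_eq_zero_of_im_ne_zero {a b c : ℝ} {z : ℂ} (hz : z.im ≠ 0)
    (h : z ^ 2 * a - z * b + c = 0) : 2 * a * z.re = b ∧ a * ‖z‖ ^ 2 = c := by
  have hre := congrArg Complex.re h
  have him := congrArg Complex.im h
  simp [pow_two] at hre him
  have h1 : 2 * a * z.re = b := by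
    apply mul_left_cancel₀ hz
    linear_combination him
  refine ⟨h1, ?_⟩
  rw [← Complex.normSq_eq_norm_sq, Complex.normSq_apply]
  linear_combination z.re * h1 - hre

theorem Complex.re_of_quadratic_eq_zero_of_im_eq_zero {a b c : ℝ} {z : ℂ} (hz : z.im = 0)
    (h : z ^ 2 * a - z * b + c = 0) : z.re ^ 2 * a - z.re * b + c = 0 := by
  have hre := congrArg Complex.re h
  simp [pow_two, hz] at hre
  linear_combination hre

namespace Network

variable {d N : ℕ} {S : Network d N} {nn : NeighborNorm}

theorem Positive.re_nonneg (hS : S.Positive nn) {z : ℂ}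
    (hz : z ∈ spectrum ℂ (S.driftMatrix nn)) : 0 ≤ z.re := by
  obtain ⟨v, hv, h⟩ := exists_eigenvector hS.mass_pos hz
  have hq := quadratic_of_eigenvector h
  have ha := sum_mul_norm_sq_pos hS.mass_pos hv
  have hb : 0 ≤ ∑ i, S.mass i * S.damping i * ‖v i‖ ^ 2 :=
    Finset.sum_nonneg fun i _ =>
      mul_nonneg (mul_nonneg (hS.mass_pos i).le (hS.damping_nonneg i)) (by positivity)
  have hc := hS.energy_pos hv
  by_cases him : z.im = 0
  · have := Complex.re_of_quadratic_eq_zero_of_im_eq_zero him hq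
    by_contra hneg
    have h1 := mul_nonneg (sq_nonneg z.re) ha.le
    have h2 := mul_nonneg (neg_nonneg.2 (not_le.1 hneg).le) hb
    linarith
  · have := (Complex.re_of_quadratic_eq_zero_of_im_ne_zero him hq).1
    exact nonneg_of_mul_nonneg_right (this ▸ hb) (by positivity)

theorem Positive.bddBelow_re_spectrum (hS : S.Positive nn) :
    BddBelow (Complex.re '' spectrum ℂ (S.driftMatrix nn)) :=
  ⟨0, by rintro _ ⟨z, hz, rfl⟩; exact hS.re_nonneg hz⟩

theorem Positive.spectralGap_nonneg (hS : S.Positive nn) : 0 ≤ S.spectralGap nn :=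
  Real.sInf_nonneg (by rintro _ ⟨z, hz, rfl⟩; exact hS.re_nonneg hz)

theorem Positive.spectralGap_le (hS : S.Positive nn) {z : ℂ}
    (hz : z ∈ spectrum ℂ (S.driftMatrix nn)) : S.spectralGap nn ≤ z.re :=
  csInf_le hS.bddBelow_re_spectrum ⟨z, hz, rfl⟩

/-- Nonemptiness matters: the real infimum of the empty set is `0` by default. -/
theorem le_spectralGap [Nonempty (Site d N)] {c : ℝ}
    (h : ∀ z ∈ spectrum ℂ (S.driftMatrix nn), c ≤ z.re) : c ≤ S.spectralGap nn :=
  le_csInf ((Matrix.spectrum_nonempty _).image _) (by rintro _ ⟨z, hz, rfl⟩; exact h z hz)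

/-- Although `m⁻¹B` need not be Hermitian, `Bv = μ m v` is a symmetric generalised eigenvalue
problem, so `μ` is a real Rayleigh quotient. -/
theorem exists_energy_eq_mul (hm : ∀ i, 0 < S.mass i) {μ : ℂ}
    (hμ : μ ∈ spectrum ℂ (S.massMatrix⁻¹ * S.schrodinger nn)) :
    ∃ v : Site d N → ℂ, v ≠ 0 ∧ (S.energy nn v : ℂ) = μ * (∑ i, S.mass i * ‖v i‖ ^ 2 : ℝ) := by
  rw [Matrix.mem_spectrum_iff_det_sub_smul_one, ← Matrix.exists_mulVec_eq_zero_iff] at hμ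
  obtain ⟨v, hv, h⟩ := hμ
  refine ⟨v, hv, ?_⟩
  rw [← sum_conj_mul_schrodinger_mulVec]
  push_cast
  simp only [← Complex.mul_conj']
  rw [Finset.mul_sum]
  refine Finset.sum_congr rfl fun i _ => ?_
  have hi := congrFun h i
  have hmi : (S.mass i : ℂ) ≠ 0 := by exact_mod_cast (hm i).ne'
  rw [inv_massMatrix hm, Matrix.sub_mulVec, Matrix.smul_mulVec, ← Matrix.mulVec_mulVec] at hi
  simp only [Matrix.one_mulVec, Pi.sub_apply, Pi.smul_apply, smul_eq_mul,
    Matrix.mulVec_diagonal, Pi.zero_apply] at hi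
  field_simp at hi
  linear_combination (starRingEnd ℂ) (v i) * hi

theorem le_re_of_mem_spectrum {η m : ℝ} (hm0 : 0 < m) (hη : 0 ≤ η)
    (hm : ∀ i, 0 < S.mass i) (hmm : ∀ i, S.mass i ≤ m) (hp : ∀ i, η ≤ S.pin i)
    (hc : ∀ i j, Neighbors nn i j → 0 < S.coupling s(i, j)) {μ : ℂ}
    (hμ : μ ∈ spectrum ℂ (S.massMatrix⁻¹ * S.schrodinger nn)) : η / m ≤ μ.re := by
  obtain ⟨v, hv, h⟩ := exists_energy_eq_mul hm hμ
  have ha := sum_mul_norm_sq_pos hm hv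
  have hre := congrArg Complex.re h
  rw [Complex.re_mul_ofReal, Complex.ofReal_re] at hre
  have h1 : η / m * ∑ i, S.mass i * ‖v i‖ ^ 2 ≤ S.energy nn v := by
    refine le_trans ?_ (sum_pin_le_energy hc v)
    rw [Finset.mul_sum]
    refine Finset.sum_le_sum fun i _ => ?_
    rw [← mul_assoc]
    refine mul_le_mul_of_nonneg_right (le_trans ?_ (hp i)) (by positivity)
    rw [div_mul_eq_mul_div, div_le_iff₀ hm0]
    exact mul_le_mul_of_nonneg_left (hmm i) hη
  rw [hre] at h1
  exact le_of_mul_le_mul_right h1 ha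

theorem Positive.infSpec_le (hS : S.Positive nn) {μ : ℂ}
    (hμ : μ ∈ spectrum ℂ (S.massMatrix⁻¹ * S.schrodinger nn)) : S.infSpec nn ≤ μ.re := by
  refine csInf_le ⟨0, ?_⟩ ⟨μ, hμ, rfl⟩
  rintro _ ⟨ν, hν, rfl⟩
  obtain ⟨v, hv, h⟩ := exists_energy_eq_mul hS.mass_pos hν
  have ha := sum_mul_norm_sq_pos hS.mass_pos hv
  have hre := congrArg Complex.re h
  rw [Complex.re_mul_ofReal, Complex.ofReal_re] at hre
  exact (pos_of_mul_pos_left (hre ▸ hS.energy_pos hv) ha.le).le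

/-! ### Uniform friction -/

theorem Positive.le_spectralGap_of_uniform_friction [Nonempty (Site d N)] (hS : S.Positive nn)
    {g δ : ℝ} (hg : 0 < g) (hfr : ∀ i, S.damping i = g) (hδ : δ ≤ S.infSpec nn) :
    min (g / 2) (δ / g) ≤ S.spectralGap nn := by
  refine le_spectralGap fun z hz => ?_
  obtain ⟨v, hv, h⟩ := exists_eigenvector hS.mass_pos hz
  have hq := quadratic_of_eigenvector h
  have ha := sum_mul_norm_sq_pos hS.mass_pos hv
  have hb : ∑ i, S.mass i * S.damping i * ‖v i‖ ^ 2 = g * ∑ i, S.mass i * ‖v i‖ ^ 2 := by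
    rw [Finset.mul_sum]
    exact Finset.sum_congr rfl fun i _ => by rw [hfr]; ring
  rw [hb] at hq
  have hμ : z * g - z ^ 2 ∈ spectrum ℂ (S.massMatrix⁻¹ * S.schrodinger nn) := by
    rw [S.mem_spectrum_driftMatrix_iff nn hS.mass_pos] at hz
    rw [Matrix.mem_spectrum_iff_det_sub_smul_one, ← hz]
    have hΓ : S.frictionMatrix = (g : ℂ) • (1 : Matrix (Site d N) (Site d N) ℂ) := by
      rw [frictionMatrix_eq, Matrix.smul_one_eq_diagonal]
      simp only [hfr]
    rw [hΓ, sub_smul, smul_smul]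
    congr 1
    abel
  have hδμ := hδ.trans (hS.infSpec_le hμ)
  set a := ∑ i, S.mass i * ‖v i‖ ^ 2
  have hc : δ * a ≤ S.energy nn v := by
    have h1 : (z * g - z ^ 2) * a = S.energy nn v := by
      push_cast at hq
      linear_combination -hq
    have h2 := congrArg Complex.re h1
    rw [Complex.re_mul_ofReal, Complex.ofReal_re] at h2
    rw [← h2]
    exact mul_le_mul_of_nonneg_right hδμ ha.le
  by_cases him : z.im = 0
  · refine (min_le_right _ _).trans ?_
    have h1 := Complex.re_of_quadratic_eq_zero_of_im_eq_zero him hq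
    rw [div_le_iff₀ hg]
    refine le_of_mul_le_mul_right ?_ ha
    linarith [mul_nonneg (sq_nonneg z.re) ha.le]
  · refine (min_le_left _ _).trans (le_of_eq ?_)
    have h1 := (Complex.re_of_quadratic_eq_zero_of_im_ne_zero him hq).1
    refine mul_right_cancel₀ ha.ne' ?_
    linarith

theorem exists_pos_le_spectralGap {g : ℝ} (hg : 0 < g) (S : (N : ℕ+) → Network d N)
    (hS : ∀ N, (S N).Positive nn) (hI : ∀ N, (S N).frictionSet = Finset.univ)
    (hfr : ∀ N i, (S N).friction i = g) (hinf : 0 < ⨅ N, (S N).infSpec nn) :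
    ∃ c : ℝ, 0 < c ∧ ∀ N, c ≤ (S N).spectralGap nn := by
  refine ⟨min (g / 2) ((⨅ N, (S N).infSpec nn) / g), by positivity, fun N => ?_⟩
  refine (hS N).le_spectralGap_of_uniform_friction hg (fun i => by simp [damping, hI, hfr]) ?_
  refine ciInf_le ?_ N
  -- An infimum that is not bounded below has the default value `0`, so positivity already gives
  -- boundedness.
  by_contra hbdd
  rw [Real.iInf_of_not_bddBelow hbdd] at hinf
  exact hinf.false

theorem iInf_infSpec_pos {m η ξ : ℝ} (hm : 0 < m) (hη : 0 < η) (hξ : 0 < ξ)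
    (S : (N : ℕ+) → Network d N) (hmass : ∀ N i, (S N).mass i = m)
    (hpin : ∀ N i, (S N).pin i = η)
    (hcoup : ∀ N i j, Neighbors nn i j → (S N).coupling s(i, j) = ξ) :
    0 < ⨅ N, (S N).infSpec nn := by
  refine (div_pos hη hm).trans_le (le_ciInf fun N => ?_)
  refine le_csInf ((Matrix.spectrum_nonempty _).image _) ?_
  rintro _ ⟨μ, hμ, rfl⟩
  exact le_re_of_mem_spectrum hm hη.le (fun i => hmass N i ▸ hm) (fun i => (hmass N i).le)
    (fun i => (hpin N i).ge) (fun i j hij => hcoup N i j hij ▸ hξ) hμ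

end Network

/-! ### Boundary friction and the trace -/

open Classical in
-- The boundary is covered by `2d` faces of `N^(d-1)` sites; the extra factor `N` avoids the
-- exponent `d - 1`.
theorem card_isBoundary_mul_le (d : ℕ) (N : ℕ+) :
    Fintype.card {i : Site d N // IsBoundary i} * (N : ℕ) ≤ 2 * d * (N : ℕ) ^ d := by
  have hface : ∀ (k : Fin d) (a : Fin N),
      (Finset.univ.filter fun i : Site d N => i k = a).card * (N : ℕ) = (N : ℕ) ^ d := by
    intro k a
    have h := Fintype.card_filter_piFinset_const_eq_of_mem (Finset.univ : Finset (Fin N)) k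
      (Finset.mem_univ a)
    rw [Fintype.piFinset_univ] at h
    rw [h, Finset.card_univ, Fintype.card_fin, Fintype.card_fin, ← pow_succ,
      Nat.sub_add_cancel k.pos]
  have hN : (N : ℕ) - 1 < N := Nat.sub_lt N.pos one_pos
  rw [Fintype.card_subtype]
  have hsub : (Finset.univ.filter fun i : Site d N => IsBoundary i) ⊆
      Finset.univ.biUnion fun k : Fin d =>
        (Finset.univ.filter fun i : Site d N => i k = ⟨0, N.pos⟩) ∪
          Finset.univ.filter fun i : Site d N => i k = ⟨(N : ℕ) - 1, hN⟩ := by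
    intro i hi
    obtain ⟨k, hk⟩ := (Finset.mem_filter.1 hi).2
    simp only [Finset.mem_biUnion, Finset.mem_union, Finset.mem_filter, Finset.mem_univ, true_and,
      Fin.ext_iff]
    exact ⟨k, by omega⟩
  calc _ ≤ (∑ k : Fin d, ((Finset.univ.filter fun i : Site d N => i k = ⟨0, N.pos⟩).card +
          (Finset.univ.filter fun i : Site d N => i k = ⟨(N : ℕ) - 1, hN⟩).card)) * (N : ℕ) := by
        refine Nat.mul_le_mul_right _ ((Finset.card_le_card hsub).trans ?_)
        exact Finset.card_biUnion_le.trans (Finset.sum_le_sum fun k _ => Finset.card_union_le _ _)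
    _ = 2 * d * (N : ℕ) ^ d := by
        rw [Finset.sum_mul]
        simp only [add_mul, hface, Finset.sum_const, Finset.card_univ, Fintype.card_fin,
          smul_eq_mul]
        ring

/-- The trace is the sum of the eigenvalues with algebraic multiplicity. -/
theorem Matrix.card_mul_le_re_trace {n : Type*} [Fintype n] [DecidableEq n] (A : Matrix n n ℂ)
    {c : ℝ} (h : ∀ z ∈ spectrum ℂ A, c ≤ z.re) : Fintype.card n * c ≤ A.trace.re := by
  have hroots : Multiset.card A.charpoly.roots = Fintype.card n := by
    rw [← A.charpoly_natDegree_eq_dim]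
    exact Polynomial.splits_iff_card_roots.1 (IsAlgClosed.splits _)
  have hsum : A.trace.re = (A.charpoly.roots.map Complex.re).sum := by
    rw [A.trace_eq_sum_roots_charpoly]
    exact map_multiset_sum Complex.reAddGroupHom _
  rw [hsum, ← hroots, ← nsmul_eq_mul]
  have := Multiset.card_nsmul_le_sum (s := A.charpoly.roots.map Complex.re) (a := c) (by
    intro x hx
    obtain ⟨z, hz, rfl⟩ := Multiset.mem_map.1 hx
    exact h z (Matrix.mem_spectrum_iff_isRoot_charpoly.2 (Polynomial.isRoot_of_mem_roots hz)))
  simpa using this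

namespace Network

variable {d : ℕ} {nn : NeighborNorm}

theorem Positive.abs_spectralGap_le {N : ℕ+} {S : Network d N} (hS : S.Positive nn) {C : ℝ}
    (hC : 0 ≤ C) (hI : ∀ i ∈ S.frictionSet, IsBoundary i ∧ S.friction i ≤ C) :
    |S.spectralGap nn| ≤ C * d / (N : ℝ) := by
  classical
  rw [abs_of_nonneg hS.spectralGap_nonneg]
  have h1 := (S.driftMatrix nn).card_mul_le_re_trace fun z hz => hS.spectralGap_le hz
  have htr : (S.driftMatrix nn).trace.re = ∑ i, S.damping i := by
    simp [driftMatrix, frictionMatrix_eq, Matrix.trace]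
  have h2 : ∑ i, S.damping i ≤ C * Fintype.card {i : Site d N // IsBoundary i} := by
    rw [Fintype.card_subtype, mul_comm, ← nsmul_eq_mul, ← Finset.sum_const, Finset.sum_filter]
    refine Finset.sum_le_sum fun i _ => ?_
    unfold damping
    by_cases hi : i ∈ S.frictionSet
    · rw [if_pos hi, if_pos (hI i hi).1]
      exact (hI i hi).2
    · rw [if_neg hi]
      split_ifs <;> simp [hC]
  have h3 : (Fintype.card {i : Site d N // IsBoundary i} : ℝ) * N ≤ 2 * d * (N : ℝ) ^ d := by
    exact_mod_cast card_isBoundary_mul_le d N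
  have hN : (0 : ℝ) < (N : ℝ) := by exact_mod_cast N.pos
  rw [htr] at h1
  simp only [Fintype.card_sum, Fintype.card_pi, Fintype.card_fin, Finset.prod_const,
    Finset.card_univ] at h1
  push_cast at h1
  rw [le_div_iff₀ hN]
  -- This is the number of eigenvalues of `M`.
  have hpow : (0 : ℝ) < 2 * (N : ℝ) ^ d := by positivity
  refine le_of_mul_le_mul_left ?_ hpow
  have h4 := mul_le_mul_of_nonneg_right (h1.trans h2) hN.le
  have h5 := mul_le_mul_of_nonneg_left h3 hC
  linarith

end Network

/-! ### The chain: transfer of eigenvectors from the left end -/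

/-- The site number `k` of a chain, counted from zero. -/
def chainSite {N : ℕ} (k : ℕ) (hk : k < N) : Site 1 N := fun _ => ⟨k, hk⟩

theorem chainSite_self {N : ℕ} (i : Site 1 N) : chainSite (i 0) (i 0).isLt = i := by
  ext k
  rw [Subsingleton.elim k 0]
  rfl

theorem neighbors_one_iff {N : ℕ} {nn : NeighborNorm} {i j : Site 1 N} :
    Neighbors nn i j ↔ (j 0 : ℕ) = i 0 + 1 ∨ (i 0 : ℕ) = j 0 + 1 := by
  cases nn <;> simp [Neighbors] <;> grind

open Classical in
theorem card_neighbors_one_le {N : ℕ} (nn : NeighborNorm) (i : Site 1 N) :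
    (Finset.univ.filter fun j => Neighbors nn i j).card ≤ 2 := by
  have h := Finset.card_le_card_of_injOn (s := Finset.univ.filter fun j => Neighbors nn i j)
    (t := {(i 0 : ℕ) + 1, (i 0 : ℕ) - 1}) (fun j : Site 1 N => (j 0 : ℕ))
    (by
      intro j hj
      have := neighbors_one_iff.1 (Finset.mem_filter.1 hj).2
      simp only [Finset.coe_insert, Finset.coe_singleton, Set.mem_insert_iff,
        Set.mem_singleton_iff]
      omega)
    (by
      intro j _ j' _ hjj
      ext k
      rw [Subsingleton.elim k 0]
      exact hjj)
  exact h.trans Finset.card_le_two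

namespace Network

variable {N : ℕ} {S : Network 1 N} {nn : NeighborNorm} {c₂ : ℝ}

theorem weight_le (hc : ∀ i j, Neighbors nn i j → S.coupling s(i, j) ≤ c₂) (h0 : 0 ≤ c₂)
    (i j : Site 1 N) : S.weight nn i j ≤ c₂ := by
  unfold weight
  split_ifs with h
  · exact hc i j h
  · exact h0

theorem sum_weight_le (hc : ∀ i j, Neighbors nn i j → S.coupling s(i, j) ≤ c₂) (h0 : 0 ≤ c₂)
    (i : Site 1 N) : ∑ j, S.weight nn i j ≤ 2 * c₂ := by
  classical
  calc ∑ j, S.weight nn i j ≤ ∑ j, if Neighbors nn i j then c₂ else 0 := by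
        refine Finset.sum_le_sum fun j _ => ?_
        unfold weight
        split_ifs with h
        · exact hc i j h
        · exact le_rfl
    _ = (Finset.univ.filter fun j => Neighbors nn i j).card * c₂ := by
        rw [← Finset.sum_filter, Finset.sum_const, nsmul_eq_mul]
    _ ≤ 2 * c₂ := by
        refine mul_le_mul_of_nonneg_right ?_ h0
        exact_mod_cast card_neighbors_one_le nn i

/-- The bonds contribute `4c₂`, from `|x - y|² ≤ 2|x|² + 2|y|²` and degree at most two; the pinning
contributes `c₂`. -/
theorem Positive.energy_le (hS : S.Positive nn)
    (hc : ∀ i j, Neighbors nn i j → S.coupling s(i, j) ≤ c₂) (h0 : 0 ≤ c₂)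
    (hp : ∀ i, S.pin i ≤ c₂) (v : Site 1 N → ℂ) :
    S.energy nn v ≤ 5 * c₂ * ∑ i, ‖v i‖ ^ 2 := by
  have h1 : ∑ i, S.pin i * ‖v i‖ ^ 2 ≤ c₂ * ∑ i, ‖v i‖ ^ 2 := by
    rw [Finset.mul_sum]
    exact Finset.sum_le_sum fun i _ => mul_le_mul_of_nonneg_right (hp i) (by positivity)
  have h2 : ∑ i, ∑ j, S.weight nn i j * ‖v i‖ ^ 2 ≤ 2 * c₂ * ∑ i, ‖v i‖ ^ 2 := by
    rw [Finset.mul_sum]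
    refine Finset.sum_le_sum fun i _ => ?_
    rw [← Finset.sum_mul]
    exact mul_le_mul_of_nonneg_right (sum_weight_le hc h0 i) (by positivity)
  have h3 : ∑ i, ∑ j, S.weight nn i j * ‖v j‖ ^ 2 = ∑ i, ∑ j, S.weight nn i j * ‖v i‖ ^ 2 := by
    rw [Finset.sum_comm]
    refine Finset.sum_congr rfl fun i _ => Finset.sum_congr rfl fun j _ => ?_
    rw [S.weight_comm nn]
  have h4 : ∑ i, ∑ j, S.weight nn i j * ‖v i - v j‖ ^ 2 ≤
      2 * ∑ i, ∑ j, S.weight nn i j * ‖v i‖ ^ 2 + 2 * ∑ i, ∑ j, S.weight nn i j * ‖v j‖ ^ 2 := by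
    simp only [Finset.mul_sum, ← Finset.sum_add_distrib]
    refine Finset.sum_le_sum fun i _ => Finset.sum_le_sum fun j _ => ?_
    have h5 : ‖v i - v j‖ ^ 2 ≤ 2 * (‖v i‖ ^ 2 + ‖v j‖ ^ 2) :=
      (pow_le_pow_left₀ (norm_nonneg _) (norm_sub_le _ _) 2).trans add_sq_le
    have h6 := mul_le_mul_of_nonneg_left h5 (weight_nonneg hS.coupling_pos i j)
    linarith
  unfold energy
  rw [h3] at h4
  linarith

/-- One step of the three-term recurrence satisfied by the eigenvectors of a chain. -/
theorem norm_chainSite_succ_le {c₁ A r : ℝ} (hc₁ : 0 < c₁) (hr : 0 ≤ r)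
    (hc : ∀ i j, Neighbors nn i j → c₁ ≤ S.coupling s(i, j) ∧ S.coupling s(i, j) ≤ c₂)
    (h0 : 0 ≤ c₂) (hp : ∀ i, |S.pin i| ≤ c₂) {t : ℂ} (ht : ‖t‖ ≤ A) {v : Site 1 N → ℂ} {k : ℕ}
    (hk : k + 1 < N) (hv : ∀ j (hj : j < N), j ≤ k → ‖v (chainSite j hj)‖ ≤ r)
    (h : t * v (chainSite k (k.lt_succ_self.trans hk)) +
      (S.schrodinger nn *ᵥ v) (chainSite k (k.lt_succ_self.trans hk)) = 0) :
    ‖v (chainSite (k + 1) hk)‖ ≤ (A + 7 * c₂) / c₁ * r := by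
  set i := chainSite k (k.lt_succ_self.trans hk) with hi
  set i' := chainSite (k + 1) hk with hi'
  have hnb : Neighbors nn i i' := neighbors_one_iff.2 (Or.inl rfl)
  have hwn : ∀ j, 0 ≤ S.weight nn i j :=
    weight_nonneg (fun i j hij => hc₁.trans_le (hc i j hij).1) i
  have hvi : ‖v i‖ ≤ r := hv k _ le_rfl
  rw [schrodinger_mulVec, ← Finset.add_sum_erase _ _ (Finset.mem_univ i')] at h
  -- Every remaining neighbour lies to the left of `i`, where `r` bounds `v`.
  have hrest : ‖∑ j ∈ Finset.univ.erase i', (S.weight nn i j : ℂ) * (v i - v j)‖ ≤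
      4 * c₂ * r := by
    calc _ ≤ ∑ j ∈ Finset.univ.erase i', S.weight nn i j * (2 * r) := by
          refine norm_sum_le_of_le _ fun j hj => ?_
          rw [norm_mul, Complex.norm_real, Real.norm_of_nonneg (hwn j)]
          by_cases hij : Neighbors nn i j
          · refine mul_le_mul_of_nonneg_left ?_ (hwn j)
            have hjk : (j 0 : ℕ) ≤ k := by
              rcases neighbors_one_iff.1 hij with h1 | h1
              · refine absurd ?_ (Finset.ne_of_mem_erase hj)
                rw [← chainSite_self j, hi']
                congr 1
              · have : (i 0 : ℕ) = k := rfl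
                omega
            have hvj := hv (j 0) (j 0).isLt hjk
            rw [chainSite_self] at hvj
            linarith [norm_sub_le (v i) (v j)]
          · simp [weight, hij]
      _ ≤ ∑ j, S.weight nn i j * (2 * r) :=
          Finset.sum_le_sum_of_subset_of_nonneg (Finset.erase_subset _ _)
            fun j _ _ => mul_nonneg (hwn j) (by positivity)
      _ ≤ 4 * c₂ * r := by
          rw [← Finset.sum_mul]
          have := mul_le_mul_of_nonneg_right (sum_weight_le (fun i j h => (hc i j h).2) h0 i)
            (by positivity : 0 ≤ 2 * r)
          linarith
  have hw1 : c₁ ≤ S.weight nn i i' := by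
    rw [weight, if_pos hnb]
    exact (hc _ _ hnb).1
  have hw2 : S.weight nn i i' ≤ c₂ := weight_le (fun i j h => (hc i j h).2) h0 i i'
  have heq : (S.weight nn i i' : ℂ) * v i' = (t + S.weight nn i i' + S.pin i) * v i +
      ∑ j ∈ Finset.univ.erase i', (S.weight nn i j : ℂ) * (v i - v j) := by
    linear_combination -h
  have hcoef : ‖t + S.weight nn i i' + S.pin i‖ ≤ A + c₂ + c₂ := by
    refine (norm_add₃_le).trans ?_
    rw [Complex.norm_real, Complex.norm_real, Real.norm_of_nonneg (hwn i')]
    exact add_le_add (add_le_add ht hw2) (hp i)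
  have hA : 0 ≤ A := (norm_nonneg t).trans ht
  have hn : S.weight nn i i' * ‖v i'‖ ≤ (A + c₂ + c₂) * r + 4 * c₂ * r := by
    have := congrArg norm heq
    rw [norm_mul, Complex.norm_real, Real.norm_of_nonneg (hwn i')] at this
    rw [this]
    refine (norm_add_le _ _).trans (add_le_add ?_ hrest)
    rw [norm_mul]
    exact mul_le_mul hcoef hvi (norm_nonneg _) (by positivity)
  have hn' := (mul_le_mul_of_nonneg_right hw1 (norm_nonneg (v i'))).trans hn
  -- The estimate gives `A + 6c₂`; the seventh `c₂` is slack.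
  rw [div_mul_eq_mul_div, le_div_iff₀ hc₁]
  linarith [mul_nonneg h0 hr]

/-- The bound covers all `j ≤ k` because the recurrence looks back two sites; it passes from `k` to
`k + 1` since the ratio is at least one. -/
theorem norm_chainSite_le {c₁ A : ℝ} (hc₁ : 0 < c₁) (hc₁₂ : c₁ ≤ c₂)
    (hc : ∀ i j, Neighbors nn i j → c₁ ≤ S.coupling s(i, j) ∧ S.coupling s(i, j) ≤ c₂)
    (hp : ∀ i, |S.pin i| ≤ c₂) {t : Site 1 N → ℂ} (ht : ∀ i, ‖t i‖ ≤ A) (hA : 0 ≤ A)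
    {v : Site 1 N → ℂ} (h : ∀ i, t i * v i + (S.schrodinger nn *ᵥ v) i = 0) (h0 : 0 < N) (k : ℕ) :
    ∀ j (hj : j < N), j ≤ k →
      ‖v (chainSite j hj)‖ ≤ ((A + 7 * c₂) / c₁) ^ k * ‖v (chainSite 0 h0)‖ := by
  have hR : 1 ≤ (A + 7 * c₂) / c₁ := by
    rw [le_div_iff₀ hc₁]
    linarith
  induction k with
  | zero =>
    intro j hj hj0
    obtain rfl : j = 0 := by omega
    simp
  | succ k ih =>
    intro j hj hjk
    rw [pow_succ', mul_assoc]
    have hnn : 0 ≤ ((A + 7 * c₂) / c₁) ^ k * ‖v (chainSite 0 h0)‖ := by positivity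
    rcases Nat.lt_or_ge k j with hkj | hkj
    · obtain rfl : j = k + 1 := by omega
      exact norm_chainSite_succ_le hc₁ hnn hc (hc₁.le.trans hc₁₂) hp (ht _) hj ih (h _)
    · exact (ih j hj hkj).trans (le_mul_of_one_le_left hnn hR)

theorem sum_norm_sq_le {c₁ A : ℝ} (hc₁ : 0 < c₁) (hc₁₂ : c₁ ≤ c₂)
    (hc : ∀ i j, Neighbors nn i j → c₁ ≤ S.coupling s(i, j) ∧ S.coupling s(i, j) ≤ c₂)
    (hp : ∀ i, |S.pin i| ≤ c₂) {t : Site 1 N → ℂ} (ht : ∀ i, ‖t i‖ ≤ A) (hA : 0 ≤ A)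
    {v : Site 1 N → ℂ} (h : ∀ i, t i * v i + (S.schrodinger nn *ᵥ v) i = 0) (h0 : 0 < N) :
    ∑ i, ‖v i‖ ^ 2 ≤ N * (((A + 7 * c₂) / c₁) ^ N) ^ 2 * ‖v (chainSite 0 h0)‖ ^ 2 := by
  have hle : ∀ i, ‖v i‖ ^ 2 ≤ (((A + 7 * c₂) / c₁) ^ N * ‖v (chainSite 0 h0)‖) ^ 2 := by
    intro i
    have := norm_chainSite_le hc₁ hc₁₂ hc hp ht hA h h0 N (i 0) (i 0).isLt (i 0).isLt.le
    rw [chainSite_self] at this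
    exact pow_le_pow_left₀ (norm_nonneg _) this 2
  refine (Finset.sum_le_card_nsmul _ _ _ fun i _ => hle i).trans (le_of_eq ?_)
  simp
  ring

theorem Positive.le_spectralGap_chain {N : ℕ+} {S : Network 1 N} (hS : S.Positive nn)
    {m g C c₁ : ℝ} (hm : 0 < m) (hg : 0 < g) (hc₁ : 0 < c₁) (hc₁₂ : c₁ ≤ c₂) (hgC : g ≤ C)
    (hmass : ∀ i, S.mass i = m) (hI : leftEnd N ∈ S.frictionSet)
    (hleft : S.friction (leftEnd N) = g) (hC : ∀ i ∈ S.frictionSet, S.friction i ≤ C)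
    (hp : ∀ i, c₁ ≤ S.pin i ∧ S.pin i ≤ c₂)
    (hc : ∀ i j, Neighbors nn i j → c₁ ≤ S.coupling s(i, j) ∧ S.coupling s(i, j) ≤ c₂) {A : ℝ}
    (hA : A = 5 * c₂ + (1 + 5 * c₂ / m) * (m * C)) :
    min (g / (2 * (N * (((A + 7 * c₂) / c₁) ^ (N : ℕ)) ^ 2))) (c₁ / (m * C)) ≤
      S.spectralGap nn := by
  have hC0 : 0 < C := hg.trans_le hgC
  have hc₂ : 0 < c₂ := hc₁.trans_le hc₁₂
  have hA0 : 0 ≤ A := by rw [hA]; positivity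
  have hN : (0 : ℝ) < N := by exact_mod_cast N.pos
  refine le_spectralGap fun z hz => ?_
  obtain ⟨v, hv, h⟩ := exists_eigenvector hS.mass_pos hz
  have hq := quadratic_of_eigenvector h
  have ha : 0 < ∑ i, ‖v i‖ ^ 2 := by
    simpa using sum_mul_norm_sq_pos (a := fun _ => 1) (fun _ => one_pos) hv
  have hdamp : ∀ i, S.damping i ≤ C := by
    intro i
    unfold damping
    split_ifs with hi
    · exact hC i hi
    · exact hC0.le
  simp only [hmass, mul_assoc m] at hq h
  rw [← Finset.mul_sum, ← Finset.mul_sum] at hq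
  by_cases him : z.im = 0
  · refine (min_le_right _ _).trans ?_
    have h1 := Complex.re_of_quadratic_eq_zero_of_im_eq_zero him hq
    have h2 : c₁ * ∑ i, ‖v i‖ ^ 2 ≤ S.energy nn v := by
      refine le_trans ?_ (sum_pin_le_energy hS.coupling_pos v)
      rw [Finset.mul_sum]
      exact Finset.sum_le_sum fun i _ => mul_le_mul_of_nonneg_right (hp i).1 (by positivity)
    have h3 : ∑ i, S.damping i * ‖v i‖ ^ 2 ≤ C * ∑ i, ‖v i‖ ^ 2 := by
      rw [Finset.mul_sum]
      exact Finset.sum_le_sum fun i _ => mul_le_mul_of_nonneg_right (hdamp i) (by positivity)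
    rw [div_le_iff₀ (by positivity)]
    refine le_of_mul_le_mul_right ?_ ha
    have h4 := mul_le_mul_of_nonneg_left h3 (mul_nonneg (hS.re_nonneg hz) hm.le)
    have h5 : 0 ≤ z.re ^ 2 * (m * ∑ i, ‖v i‖ ^ 2) := by positivity
    linarith
  · refine (min_le_left _ _).trans ?_
    obtain ⟨h1, h2⟩ := Complex.re_of_quadratic_eq_zero_of_im_ne_zero him hq
    have hz2 : ‖z‖ ^ 2 ≤ 5 * c₂ / m := by
      rw [le_div_iff₀ hm]
      refine le_of_mul_le_mul_right ?_ ha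
      have := hS.energy_le (fun i j h => (hc i j h).2) hc₂.le (fun i => (hp i).2) v
      linarith
    -- The bound `|z| ≤ 1 + |z|²` avoids a square root.
    have hz1 : ‖z‖ ≤ 1 + 5 * c₂ / m := by nlinarith [sq_nonneg (‖z‖ - 1)]
    have ht : ∀ i, ‖z ^ 2 * m - z * (m * S.damping i)‖ ≤ A := by
      intro i
      refine (norm_sub_le _ _).trans ?_
      rw [norm_mul, norm_mul, norm_mul, norm_pow, Complex.norm_real, Complex.norm_real,
        Real.norm_of_nonneg hm.le, Real.norm_of_nonneg (hS.damping_nonneg i), hA]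
      refine add_le_add ((le_div_iff₀ hm).1 hz2) (mul_le_mul hz1 ?_ ?_ (by positivity))
      · exact mul_le_mul_of_nonneg_left (hdamp i) hm.le
      · exact mul_nonneg hm.le (hS.damping_nonneg i)
    have h3 := sum_norm_sq_le hc₁ hc₁₂ hc
      (fun i => by rw [abs_of_pos (hS.pin_pos i)]; exact (hp i).2) ht hA0 h N.pos
    have h4 : g * ‖v (leftEnd N)‖ ^ 2 ≤ ∑ i, S.damping i * ‖v i‖ ^ 2 := by
      have hd : S.damping (leftEnd N) = g := by rw [damping, if_pos hI, hleft]
      rw [← hd]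
      exact Finset.single_le_sum (f := fun i => S.damping i * ‖v i‖ ^ 2)
        (fun i _ => mul_nonneg (hS.damping_nonneg i) (by positivity)) (Finset.mem_univ _)
    set P : ℝ := N * (((A + 7 * c₂) / c₁) ^ (N : ℕ)) ^ 2 with hP
    have hP0 : 0 < P := by positivity
    have h1' : 2 * (∑ i, ‖v i‖ ^ 2) * z.re = ∑ i, S.damping i * ‖v i‖ ^ 2 := by
      refine mul_left_cancel₀ hm.ne' ?_
      linarith
    rw [div_le_iff₀ (by positivity)]
    refine le_of_mul_le_mul_right ?_ ha
    have h5 := mul_le_mul_of_nonneg_left h3 hg.le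
    have h6 := mul_le_mul_of_nonneg_left h4 hP0.le
    have h7 : g * (P * ‖v (chainSite 0 N.pos)‖ ^ 2) = P * (g * ‖v (leftEnd N)‖ ^ 2) := by
      rw [mul_left_comm]
      rfl
    rw [h7] at h5
    refine (h5.trans h6).trans (le_of_eq ?_)
    rw [← h1']
    ring

theorem exists_exp_le_spectralGap (nn : NeighborNorm) {m g C c₁ c₂ : ℝ} (hm : 0 < m) (hg : 0 < g)
    (hc₁ : 0 < c₁) :
    ∃ c : ℝ, 0 < c ∧ ∀ (N : ℕ+) (S : Network 1 N), S.Positive nn →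
      (∀ i, S.mass i = m) →
      leftEnd N ∈ S.frictionSet →
      S.friction (leftEnd N) = g →
      (∀ i ∈ S.frictionSet, S.friction i ≤ C) →
      (∀ i, c₁ < S.pin i ∧ S.pin i < c₂) →
      (∀ i j, Neighbors nn i j → c₁ < S.coupling s(i, j) ∧ S.coupling s(i, j) < c₂) →
      Real.exp (-(c * (N : ℝ))) ≤ S.spectralGap nn := by
  by_cases hyp : g ≤ C ∧ c₁ ≤ c₂
  swap
  -- If `C < g` or `c₂ < c₁`, no chain satisfies the hypotheses, and any positive `c` will do.
  · refine ⟨1, one_pos, fun N S _ _ hI hleft hC hp _ => (hyp ⟨?_, ?_⟩).elim⟩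
    · exact hleft ▸ hC _ hI
    · exact ((hp (leftEnd N)).1.trans (hp (leftEnd N)).2).le
  obtain ⟨hgC, hc₁₂⟩ := hyp
  have hC0 : 0 < C := hg.trans_le hgC
  have hc₂ : 0 < c₂ := hc₁.trans_le hc₁₂
  set R : ℝ := (5 * c₂ + (1 + 5 * c₂ / m) * (m * C) + 7 * c₂) / c₁ with hR
  have hR0 : 0 < R := by positivity
  -- `Q` is chosen so that `Q ^ N` exceeds the reciprocals of both lower bounds: `m * C / c₁`, and
  -- `2N * R^(2N) / g` through `2N ≤ 4^N` and `1 / g ≤ (1 + 1 / g)^N`.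
  set Q : ℝ := 1 + m * C / c₁ + 4 * R ^ 2 * (1 + 1 / g) with hQ
  have hQ1 : 1 < Q := by
    have h1 : 0 < m * C / c₁ := by positivity
    have h2 : 0 < 4 * R ^ 2 * (1 + 1 / g) := by positivity
    linarith
  refine ⟨Real.log Q, Real.log_pos hQ1, fun N S hS hmass hI hleft hC hp hc => ?_⟩
  refine le_trans ?_ (hS.le_spectralGap_chain hm hg hc₁ hc₁₂ hgC hmass hI hleft hC
    (fun i => ⟨(hp i).1.le, (hp i).2.le⟩) (fun i j h => ⟨(hc i j h).1.le, (hc i j h).2.le⟩) rfl)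
  have hN : (0 : ℝ) < N := by exact_mod_cast N.pos
  have hexp : Real.exp (-(Real.log Q * (N : ℝ))) = (Q ^ (N : ℕ))⁻¹ := by
    rw [Real.exp_neg, mul_comm, Real.exp_nat_mul, Real.exp_log (by linarith)]
  rw [hexp, ← hR]
  refine le_min ?_ ?_
  · rw [← inv_div]
    refine inv_anti₀ (by positivity) ?_
    have h1 : 4 * R ^ 2 * (1 + 1 / g) ≤ Q := by
      have : 0 < m * C / c₁ := by positivity
      linarith
    refine le_trans ?_ (pow_le_pow_left₀ (by positivity) h1 _)
    rw [mul_pow, mul_pow, div_eq_mul_one_div]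
    have h2 : 2 * (N : ℝ) ≤ 4 ^ (N : ℕ) := by
      have h3 : (2 : ℕ) * N ≤ 4 ^ (N : ℕ) := by
        have h4 : (N : ℕ) < 2 ^ (N : ℕ) := Nat.lt_two_pow_self
        have h5 : 2 ≤ 2 ^ (N : ℕ) := by
          simpa using Nat.pow_le_pow_right two_pos N.pos
        calc 2 * (N : ℕ) ≤ 2 ^ (N : ℕ) * 2 ^ (N : ℕ) := Nat.mul_le_mul h5 h4.le
          _ = 4 ^ (N : ℕ) := (mul_pow 2 2 _).symm
      exact_mod_cast h3
    have h6 : 1 / g ≤ (1 + 1 / g) ^ (N : ℕ) :=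
      (le_add_of_nonneg_left zero_le_one).trans
        (le_self_pow₀ (le_add_of_nonneg_right (by positivity)) N.pos.ne')
    rw [← mul_assoc, pow_right_comm R]
    exact mul_le_mul (mul_le_mul_of_nonneg_right h2 (by positivity)) h6 (by positivity)
      (by positivity)
  · rw [← inv_div]
    refine inv_anti₀ (by positivity) ?_
    refine le_trans ?_ (le_self_pow₀ hQ1.le N.pos.ne')
    have : 0 < 4 * R ^ 2 * (1 + 1 / g) := by positivity
    linarith

end Network

theorem mainTheorem6 (d : ℕ) (hd : 1 ≤ d) (nn : NeighborNorm) :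
    -- (1) characteristic polynomial of the drift matrix and its invertibility
    (∀ (N : ℕ+) (S : Network d N), (∀ i, 0 < S.mass i) →
      (∀ z : ℂ,
        (S.driftMatrix nn - z • (1 : Matrix (Site d N ⊕ Site d N) (Site d N ⊕ Site d N) ℂ)).det =
          (z ^ 2 • (1 : Matrix (Site d N) (Site d N) ℂ) - z • S.frictionMatrix +
            S.massMatrix⁻¹ * S.schrodinger nn).det) ∧
      (∀ z : ℂ, z ∈ spectrum ℂ (S.driftMatrix nn) ↔
        (z ^ 2 • (1 : Matrix (Site d N) (Site d N) ℂ) - z • S.frictionMatrix +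
          S.massMatrix⁻¹ * S.schrodinger nn).det = 0) ∧
      (IsUnit (S.driftMatrix nn) ↔ IsUnit (S.schrodinger nn))) ∧
    -- (2) equal friction at every oscillator: the gap is uniform in `N`
    (∀ g : ℝ, 0 < g → ∀ S : (N : ℕ+) → Network d N,
      (∀ N, (S N).Positive nn) →
      (∀ N, (S N).frictionSet = Finset.univ) →
      (∀ N i, (S N).friction i = g) →
      0 < ⨅ N, (S N).infSpec nn →
      ∃ c : ℝ, 0 < c ∧ ∀ N, c ≤ (S N).spectralGap nn) ∧
    (∀ m η ξ : ℝ, 0 < m → 0 < η → 0 < ξ → ∀ S : (N : ℕ+) → Network d N,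
      (∀ N i, (S N).mass i = m) →
      (∀ N i, (S N).pin i = η) →
      (∀ N i j, Neighbors nn i j → (S N).coupling s(i, j) = ξ) →
      0 < ⨅ N, (S N).infSpec nn) ∧
    -- (3) bounded friction that acts on the boundary only: the gap is `O(1 / N)`
    (∀ C : ℝ, ∃ K : ℝ, ∀ (N : ℕ+) (S : Network d N), S.Positive nn →
      (∀ i ∈ S.frictionSet, IsBoundary i ∧ S.friction i ≤ C) →
      |S.spectralGap nn| ≤ K / (N : ℝ)) ∧
    -- (4) chain with friction at its left end: the gap is at least exponentially small
    (∀ m g C c₁ c₂ : ℝ, 0 < m → 0 < g → 0 < c₁ →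
      ∃ c : ℝ, 0 < c ∧ ∀ (N : ℕ+) (S : Network 1 N), S.Positive nn →
        (∀ i, S.mass i = m) →
        leftEnd N ∈ S.frictionSet →
        S.friction (leftEnd N) = g →
        (∀ i ∈ S.frictionSet, S.friction i ≤ C) →
        (∀ i, c₁ < S.pin i ∧ S.pin i < c₂) →
        (∀ i j, Neighbors nn i j → c₁ < S.coupling s(i, j) ∧ S.coupling s(i, j) < c₂) →
        Real.exp (-(c * (N : ℝ))) ≤ S.spectralGap nn) := by
  refine ⟨fun N S hm => ⟨S.det_driftMatrix_sub nn hm, S.mem_spectrum_driftMatrix_iff nn hm,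
    S.isUnit_driftMatrix_iff nn hm⟩, fun g hg S hS hI hfr hinf =>
    Network.exists_pos_le_spectralGap hg S hS hI hfr hinf,
    fun m η ξ hm hη hξ S hmass hpin hc => Network.iInf_infSpec_pos hm hη hξ S hmass hpin hc,
    -- The maximum keeps the constant nonnegative when `C < 0`, which forces the friction set to be
    -- empty.
    fun C => ⟨max C 0 * d, fun N S hS hI => hS.abs_spectralGap_le (le_max_right _ _)
      fun i hi => ⟨(hI i hi).1, (hI i hi).2.trans (le_max_left _ _)⟩⟩,
    fun m g C c₁ c₂ hm hg hc₁ => Network.exists_exp_le_spectralGap nn hm hg hc₁⟩
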